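/- There are absolute constants $c_0\in(0,1)$ and $c_1>0$ such that the following holds. Let $m\ge 1$, let $A\in\mathbb{R}^{m\times m}$ and $C\in\mathbb{R}^{n\times n}$ be symmetric, $B\in\mathbb{R}^{n\times m}$, $z^*=(x^*,y^*)\in\mathbb{R}^n\times\mathbb{R}^m$, and $$f(x;y)=-\tfrac12(y-y^*)^\top A(y-y^*)+(x-x^*)^\top B(y-y^*)+\tfrac12(x-x^*)^\top C(x-x^*).$$ Suppose that $\mu I\le A\le LI$ with $\mu>0$, that $\|B\|_2\le L$ and $\|C\|_2\le L$, and that $C+BA^{-1}B^\top\ge\mu_x I$ with $0<\mu_x\le L$. Put $\kappa=L/\mu$ and $\kappa_x=L/\mu_x$, let $r\ge 2\kappa$, $\eta_x=\frac1{4rL}$, $\eta_y=\frac1{4L}$, and $$M=\begin{pmatrix}-C&-B\\ rB^\top&-rA\end{pmatrix}.$$ Let $M=P^{-1}JP$ be any Jordan decomposition of $M$ over $\mathbb{C}$ ($M$ need not be diagonalizable), let $s$ be the size of the largest Jordan block of $J$, and let $C_P=\|P\|_2\|P^{-1}\|_2$. Let $z^0\in\mathbb{R}^n\times\mathbb{R}^m$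 be arbitrary and let $z^T=(x^T,y^T)$ be the iterates, with exact gradients, of either gradient descent ascent (GDA), $$x^{k+1}=x^k-\eta_x\nabla_xf(x^k;y^k),\qquad y^{k+1}=y^k+\eta_y\nabla_yf(x^k;y^k),$$ or extra-gradient (EG), $$x^{k+1/2}=x^k-\eta_x\nabla_xf(x^k;y^k),\qquad y^{k+1/2}=y^k+\eta_y\nabla_yf(x^k;y^k),$$ $$x^{k+1}=x^k-\eta_x\nabla_xf(x^{k+1/2};y^{k+1/2}),\qquad y^{k+1}=y^k+\eta_y\nabla_yf(x^{k+1/2};y^{k+1/2}).$$ Then for every integer $T\ge1$, and also for $T=0$ if $s=1$ (with $0^0=1$), $$\|z^T-z^*\|_2\le s\,C_P\,\|z^0-z^*\|_2\,T^{s-1}\Bigl(1-\frac{c_0}{r\kappa_x}\Bigr)^{T-s+1}.$$ Moreover, for every $0<\varepsilon\le\|z^0-z^*\|_2$ there is a number of iterations $T_0$, using in total ($1$ gradient evaluation per iteration for GDA, $2$ for EG) at most $$c_1\,s\,r\,\kappa_x\log\Bigl(\frac{s\,r\,\kappa_x\,C_P\,\|z^0-z^*\|_2}{\varepsilon}\Bigr)$$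 gradient evaluations, such that $\|z^T-z^*\|_2\le\varepsilon$ for all $T\ge T_0$. -/

import Mathlib

open scoped Matrix.Norms.L2Operator

noncomputable section

namespace Minimax

/-- The space `ℝⁿ × ℝᵐ` with the Euclidean norm `‖(x, y)‖² = ‖x‖² + ‖y‖²`. -/
abbrev Pt (n m : ℕ) : Type :=
  WithLp 2 (EuclideanSpace ℝ (Fin n) × EuclideanSpace ℝ (Fin m))

/-- The partial gradient of `f` with respect to the minimization variable `x`. -/
def gradX {n m : ℕ} (f : EuclideanSpace ℝ (Fin n) → EuclideanSpace ℝ (Fin m) → ℝ)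
    (z : Pt n m) : EuclideanSpace ℝ (Fin n) :=
  gradient (fun x => f x z.snd) z.fst

/-- The partial gradient of `f` with respect to the maximization variable `y`. -/
def gradY {n m : ℕ} (f : EuclideanSpace ℝ (Fin n) → EuclideanSpace ℝ (Fin m) → ℝ)
    (z : Pt n m) : EuclideanSpace ℝ (Fin m) :=
  gradient (fun y => f z.fst y) z.snd

/-- One step of two-time-scale gradient descent ascent with an exact gradient oracle. -/
def gdaStep {n m : ℕ} (f : EuclideanSpace ℝ (Fin n) → EuclideanSpace ℝ (Fin m) → ℝ)
    (ηx ηy : ℝ) (z : Pt n m) : Pt n m :=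
  WithLp.toLp 2 (z.fst - ηx • gradX f z, z.snd + ηy • gradY f z)

/-- One step of two-time-scale extra-gradient with an exact gradient oracle: the gradients are
evaluated at the half step and applied at the current point. -/
def egStep {n m : ℕ} (f : EuclideanSpace ℝ (Fin n) → EuclideanSpace ℝ (Fin m) → ℝ)
    (ηx ηy : ℝ) (z : Pt n m) : Pt n m :=
  WithLp.toLp 2
    (z.fst - ηx • gradX f (gdaStep f ηx ηy z), z.snd + ηy • gradY f (gdaStep f ηx ηy z))

/-- The two algorithms: gradient descent ascent and extra-gradient. -/
inductive Algo : Type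
  | gda : Algo
  | eg : Algo

/-- One iteration of the algorithm. -/
def Algo.step {n m : ℕ} (alg : Algo)
    (f : EuclideanSpace ℝ (Fin n) → EuclideanSpace ℝ (Fin m) → ℝ)
    (ηx ηy : ℝ) (z : Pt n m) : Pt n m :=
  match alg with
  | Algo.gda => gdaStep f ηx ηy z
  | Algo.eg => egStep f ηx ηy z

/-- The number of gradient evaluations in one iteration. -/
def Algo.gradCalls (alg : Algo) : ℕ :=
  match alg with
  | Algo.gda => 1
  | Algo.eg => 2

/-- The iterate `z^T` started at `z⁰`. -/
def Algo.iterate {n m : ℕ} (alg : Algo)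
    (f : EuclideanSpace ℝ (Fin n) → EuclideanSpace ℝ (Fin m) → ℝ)
    (ηx ηy : ℝ) (z₀ : Pt n m) (T : ℕ) : Pt n m :=
  (alg.step f ηx ηy)^[T] z₀

/-- The quadratic function
`f(x; y) = -½ (y-y*)ᵀ A (y-y*) + (x-x*)ᵀ B (y-y*) + ½ (x-x*)ᵀ C (x-x*)`. -/
def quadratic {n m : ℕ} (A : Matrix (Fin m) (Fin m) ℝ) (B : Matrix (Fin n) (Fin m) ℝ)
    (C : Matrix (Fin n) (Fin n) ℝ) (zs : Pt n m)
    (x : EuclideanSpace ℝ (Fin n)) (y : EuclideanSpace ℝ (Fin m)) : ℝ :=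
  -(1 / 2) * ((y - zs.snd).ofLp ⬝ᵥ (A.mulVec (y - zs.snd).ofLp))
    + (x - zs.fst).ofLp ⬝ᵥ (B.mulVec (y - zs.snd).ofLp)
    + (1 / 2) * ((x - zs.fst).ofLp ⬝ᵥ (C.mulVec (x - zs.fst).ofLp))

/-- The standing assumptions on the quadratic function: `A`, `C` are symmetric,
`μ I ≤ A ≤ L I`, `‖B‖₂, ‖C‖₂ ≤ L`, `C + B A⁻¹ Bᵀ ≥ μₓ I`, with `μ > 0` and `0 < μₓ ≤ L`. The norms
are spectral norms. -/
structure QuadAssumption {n m : ℕ} (A : Matrix (Fin m) (Fin m) ℝ) (B : Matrix (Fin n) (Fin m) ℝ)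
    (C : Matrix (Fin n) (Fin n) ℝ) (L μ μx : ℝ) : Prop where
  symm_A : A.IsSymm
  symm_C : C.IsSymm
  mu_pos : 0 < μ
  mu_le : (A - μ • (1 : Matrix (Fin m) (Fin m) ℝ)).PosSemidef
  le_L : (L • (1 : Matrix (Fin m) (Fin m) ℝ) - A).PosSemidef
  norm_B : ‖B‖ ≤ L
  norm_C : ‖C‖ ≤ L
  mux_pos : 0 < μx
  mux_le_L : μx ≤ L
  mux_le : (C + B * A⁻¹ * B.transpose - μx • (1 : Matrix (Fin n) (Fin n) ℝ)).PosSemidef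

/-- The matrix `M = [[-C, -B], [r Bᵀ, -r A]]` governing the dynamics. -/
def dynMatrix {n m : ℕ} (A : Matrix (Fin m) (Fin m) ℝ) (B : Matrix (Fin n) (Fin m) ℝ)
    (C : Matrix (Fin n) (Fin n) ℝ) (r : ℝ) : Matrix (Fin n ⊕ Fin m) (Fin n ⊕ Fin m) ℝ :=
  Matrix.fromBlocks (-C) (-B) (r • B.transpose) (-(r • A))

/-- The Jordan block of size `d` with eigenvalue `lam`: `lam` on the diagonal, `1` on the
superdiagonal. -/
def jordanBlock (lam : ℂ) (d : ℕ) : Matrix (Fin d) (Fin d) ℂ :=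
  Matrix.of fun i j =>
    if i = j then lam else if (i : ℕ) + 1 = (j : ℕ) then 1 else 0

/-- A Jordan decomposition `M = P⁻¹ J P` of a complex square matrix: `P` is invertible and `J` is
block diagonal with Jordan blocks, the `i`-th one of size `size i ≥ 1` with eigenvalue `eig i`.
The bijection `e` lists the coordinates block by block. -/
structure JordanDecomp {ι : Type} [Fintype ι] [DecidableEq ι] (M : Matrix ι ι ℂ) where
  numBlocks : ℕ
  size : Fin numBlocks → ℕ
  size_pos : ∀ i, 0 < size i
  eig : Fin numBlocks → ℂ
  e : ι ≃ (Σ i, Fin (size i))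
  P : Matrix ι ι ℂ
  isUnit_P : IsUnit P
  eq : M = P⁻¹ * (Matrix.blockDiagonal' fun i => jordanBlock (eig i) (size i)).submatrix e e * P

/-- The size of the largest Jordan block. -/
def JordanDecomp.maxSize {ι : Type} [Fintype ι] [DecidableEq ι] {M : Matrix ι ι ℂ}
    (D : JordanDecomp M) : ℕ :=
  Finset.univ.sup D.size

/-- The condition number `‖P‖₂ ‖P⁻¹‖₂` in the spectral norm. -/
def JordanDecomp.condP {ι : Type} [Fintype ι] [DecidableEq ι] {M : Matrix ι ι ℂ}
    (D : JordanDecomp M) : ℝ :=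
  ‖D.P‖ * ‖D.P⁻¹‖

end Minimax

end

/-! ### Powers of the identity plus a Jordan-type perturbation. -/

section

open Finset

/-! On a quadratic both methods are linear: `z - z*` is multiplied at each iteration by `1 + Q`,
where `Q = ηM` for GDA, `Q = ηM + (ηM)²` for EG, and `η = η_x`. Two facts give the rate.

Spectrum. Every eigenvalue `l` of `M` satisfies `Re l ≤ -μₓ/2` and `(Im l)² ≤ -2rL Re l`. For a real
eigenvalue this comes from the Schur complement `C + BA⁻¹Bᵀ`; for a non-real one, the two components
of the eigenvector must satisfy `‖v‖² = r‖u‖²`, so the strongly concave block dominates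
(`real_eigenvalue_le`, `nonreal_eigenvalue_bounds`). With `‖ηM‖ ≤ 2/5`, the multipliers `1 + ηl` and
`1 + ηl + (ηl)²` then have modulus at most `1 - 1/(16 r κₓ)`.

Jordan blocks. `Q` is conjugate by `P` to `D + G`, with `D` diagonal, `G` nilpotent and commuting
with `D`. Expanding `(1 + D + G)^T` leaves the powers `G^j` with `j < s`. Their norms are not under
control: the superdiagonal ones are multiplied by `η`, which is large when `L` is small. Instead `G
= (D + G) - D` is expanded again, and powers of `D + G` are carried through `P` to become powers of
`Q`. Each conjugated term then costs a single factor `‖P‖‖P⁻¹‖` times `(‖D‖ + ‖Q‖)^j`, which is at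
most `1` for these step sizes (`SemiconjBy.norm_conj_mul_pow_le`).

The iteration count follows by taking logarithms in the resulting bound (`mul_pow_mul_pow_le_one`).
-/

theorem SemiconjBy.norm_conj_mul_pow_le {𝔸 : Type*} [NormedRing 𝔸] [NormOneClass 𝔸]
    {P P' Q D G X : 𝔸} (hQ : SemiconjBy P Q (D + G)) (hDG : Commute D G)
    (hD : ‖D‖ + ‖Q‖ ≤ 1) (j : ℕ) :
    ‖P' * (X * G ^ j) * P‖ ≤ ‖P‖ * ‖P'‖ * ‖X‖ := by
  have hG : G ^ j = ∑ i ∈ range (j + 1), (-D) ^ i * (D + G) ^ (j - i) * (j.choose i : 𝔸) := by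
    have : G = -D + (D + G) := by abel
    conv_lhs => rw [this]
    exact Commute.add_pow (((Commute.refl D).add_right hDG).neg_left) j
  -- Moving `P` to the left of `(D + G)^(j - i)` turns that factor into `Q^(j - i)`, whose norm is
  -- known.
  have hterm : ∀ i, P' * (X * ((-D) ^ i * (D + G) ^ (j - i) * (j.choose i : 𝔸))) * P =
      j.choose i • (P' * X * (-D) ^ i * P * Q ^ (j - i)) := by
    intro i
    have h : P * Q ^ (j - i) = (D + G) ^ (j - i) * P := (hQ.pow_right (j - i)).eq
    rw [mul_assoc (P' * X * (-D) ^ i), h, nsmul_eq_mul, ← (Nat.cast_commute (j.choose i) _).eq.symm]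
    simp only [mul_assoc, (Nat.cast_commute (j.choose i) P).eq]
  have hb : ∀ i, ‖P' * (X * ((-D) ^ i * (D + G) ^ (j - i) * (j.choose i : 𝔸))) * P‖ ≤
      ‖P‖ * ‖P'‖ * ‖X‖ * (‖D‖ ^ i * ‖Q‖ ^ (j - i) * (j.choose i : ℝ)) := by
    intro i
    rw [hterm]
    calc _ ≤ (j.choose i : ℝ) * ‖P' * X * (-D) ^ i * P * Q ^ (j - i)‖ := norm_nsmul_le
      _ ≤ (j.choose i : ℝ) * (‖P'‖ * ‖X‖ * ‖D‖ ^ i * ‖P‖ * ‖Q‖ ^ (j - i)) := by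
        gcongr
        refine (norm_mul_le _ _).trans (mul_le_mul ?_ (norm_pow_le _ _) (norm_nonneg _)
          (by positivity))
        refine (norm_mul_le _ _).trans (mul_le_mul_of_nonneg_right ?_ (norm_nonneg _))
        refine (norm_mul_le _ _).trans (mul_le_mul (norm_mul_le _ _) ?_ (norm_nonneg _)
          (by positivity))
        simpa using norm_pow_le (-D) i
      _ = _ := by ring
  rw [hG, mul_sum, mul_sum, sum_mul]
  calc _ ≤ ∑ i ∈ range (j + 1), ‖P‖ * ‖P'‖ * ‖X‖ * (‖D‖ ^ i * ‖Q‖ ^ (j - i) * (j.choose i : ℝ)) :=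
        (norm_sum_le _ _).trans (sum_le_sum fun i _ => hb i)
    _ = ‖P‖ * ‖P'‖ * ‖X‖ * (‖D‖ + ‖Q‖) ^ j := by rw [← mul_sum, ← add_pow]
    _ ≤ ‖P‖ * ‖P'‖ * ‖X‖ * 1 := by
        gcongr
        exact pow_le_one₀ (by positivity) hD
    _ = _ := mul_one _

/-- If `Q` is similar to `D + G` with `G` nilpotent and commuting with `D`, the powers of `1 + Q`
are controlled by those of `1 + D`; the bound does not involve the size of `G`. -/
theorem norm_one_add_pow_le_of_semiconjBy {𝔸 : Type*} [NormedRing 𝔸] [NormOneClass 𝔸]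
    {P P' Q D G : 𝔸} {ρ : ℝ} {s : ℕ} (hP : P' * P = 1) (hQ : SemiconjBy P Q (D + G))
    (hDG : Commute D G) (hG : G ^ s = 0) (hD : ‖D‖ + ‖Q‖ ≤ 1) (hρ : ‖1 + D‖ ≤ ρ) (T : ℕ) :
    ‖(1 + Q) ^ T‖ ≤ ‖P‖ * ‖P'‖ * ∑ j ∈ range s, (T.choose j : ℝ) * ρ ^ (T - j) := by
  have h1 : (1 + Q) ^ T = P' * (1 + D + G) ^ T * P := by
    have h : P * (1 + Q) ^ T = (1 + D + G) ^ T * P := by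
      have := ((SemiconjBy.one_right P).add_right hQ).pow_right T
      rw [← add_assoc] at this
      exact this.eq
    rw [mul_assoc, ← h, ← mul_assoc, hP, one_mul]
  have h2 : (1 + D + G) ^ T =
      ∑ j ∈ range (T + 1), T.choose j • ((1 + D) ^ (T - j) * G ^ j) := by
    have hc : Commute G (1 + D) := (Commute.one_right G).add_right hDG.symm
    rw [add_comm (1 + D) G, hc.add_pow]
    refine sum_congr rfl fun j _ => ?_
    rw [(hc.pow_pow j (T - j)).eq, nsmul_eq_mul, (Nat.cast_commute (T.choose j) _).eq]
  have hρ0 : 0 ≤ ρ := (norm_nonneg _).trans hρ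
  have h3 : ∀ j, ‖P' * (T.choose j • ((1 + D) ^ (T - j) * G ^ j)) * P‖ ≤
      if j < s then ‖P‖ * ‖P'‖ * ((T.choose j : ℝ) * ρ ^ (T - j)) else 0 := by
    intro j
    split_ifs with hj
    · rw [mul_smul_comm, smul_mul_assoc]
      calc _ ≤ (T.choose j : ℝ) * ‖P' * ((1 + D) ^ (T - j) * G ^ j) * P‖ := norm_nsmul_le
        _ ≤ (T.choose j : ℝ) * (‖P‖ * ‖P'‖ * ‖(1 + D) ^ (T - j)‖) := by
          gcongr
          exact hQ.norm_conj_mul_pow_le hDG hD j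
        _ ≤ (T.choose j : ℝ) * (‖P‖ * ‖P'‖ * ρ ^ (T - j)) := by
          gcongr
          exact (norm_pow_le _ _).trans (pow_le_pow_left₀ (norm_nonneg _) hρ _)
        _ = _ := by ring
    · rw [pow_eq_zero_of_le (not_lt.mp hj) hG]
      simp
  rw [h1, h2, mul_sum, sum_mul]
  refine (norm_sum_le _ _).trans ((sum_le_sum fun j _ => h3 j).trans ?_)
  rw [← sum_filter, mul_sum]
  refine sum_le_sum_of_subset_of_nonneg ?_ fun j _ _ => by positivity
  intro j
  simp +contextual

/-- Each of the `s` terms is at most the largest polynomial factor times the weakest decay. The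
integer exponent may be negative when `T < s - 1`; this only enlarges the right side, since `0 < ρ ≤
1`. For `T = 0` the bound `T^j ≤ T^(s-1)` can fail, hence the restriction to `s = 1`. -/
theorem sum_choose_mul_pow_le {ρ : ℝ} (h0 : 0 < ρ) (h1 : ρ ≤ 1) {s T : ℕ} (hT : 1 ≤ T ∨ s = 1) :
    ∑ j ∈ range s, (T.choose j : ℝ) * ρ ^ (T - j) ≤
      s * (T : ℝ) ^ (s - 1) * ρ ^ ((T : ℤ) - (s : ℤ) + 1) := by
  have h : ∀ j ∈ range s, (T.choose j : ℝ) * ρ ^ (T - j) ≤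
      (T : ℝ) ^ (s - 1) * ρ ^ ((T : ℤ) - (s : ℤ) + 1) := by
    intro j hj
    rw [mem_range] at hj
    rcases lt_or_ge T j with hTj | hTj
    · rw [Nat.choose_eq_zero_of_lt hTj]
      simp only [Nat.cast_zero, zero_mul]
      positivity
    · have hp : ρ ^ (T - j) ≤ ρ ^ ((T : ℤ) - (s : ℤ) + 1) := by
        rw [← zpow_natCast]
        exact zpow_le_zpow_right_of_le_one₀ h0 h1 (by omega)
      have hc : (T.choose j : ℝ) ≤ (T : ℝ) ^ (s - 1) := by
        rcases hT with hT | rfl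
        · calc (T.choose j : ℝ) ≤ (T : ℝ) ^ j := by exact_mod_cast Nat.choose_le_pow T j
            _ ≤ _ := pow_le_pow_right₀ (by exact_mod_cast hT) (by omega)
        · obtain rfl : j = 0 := by omega
          simp
      gcongr
  refine (sum_le_sum h).trans_eq ?_
  simp [mul_assoc]

/-! ### Diagonal and nilpotent parts of a Jordan matrix. -/

namespace Minimax.JordanDecomp

variable {ι : Type} [Fintype ι] [DecidableEq ι] {M : Matrix ι ι ℂ}

/-- The diagonal part of the Jordan matrix. -/
def diagPart (D : JordanDecomp M) : Matrix ι ι ℂ :=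
  Matrix.diagonal fun x => D.eig (D.e x).1

/-- The nilpotent part of the Jordan matrix. -/
def nilPart (D : JordanDecomp M) : Matrix ι ι ℂ :=
  (Matrix.blockDiagonal' fun i => jordanBlock (D.eig i) (D.size i)).submatrix D.e D.e - D.diagPart

theorem nilPart_apply_ne_zero (D : JordanDecomp M) {x y : ι} (h : D.nilPart x y ≠ 0) :
    (D.e x).1 = (D.e y).1 ∧ ((D.e x).2 : ℕ) + 1 = ((D.e y).2 : ℕ) := by
  have key : D.nilPart x y = (Matrix.blockDiagonal' fun i => jordanBlock (D.eig i) (D.size i))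
      (D.e x) (D.e y) - if D.e x = D.e y then D.eig (D.e x).1 else 0 := by
    simp [nilPart, diagPart, Matrix.diagonal_apply]
  rw [key] at h
  generalize D.e x = p at h ⊢
  generalize D.e y = q at h ⊢
  obtain ⟨i, a⟩ := p
  obtain ⟨k, b⟩ := q
  by_cases hik : i = k
  · subst hik
    rw [Matrix.blockDiagonal'_apply_eq] at h
    simp only [jordanBlock, Matrix.of_apply, Sigma.mk.injEq, heq_eq_eq, true_and] at h
    by_cases hab : a = b
    · simp [hab] at h
    · simp only [hab, if_false, sub_zero] at h
      exact ⟨rfl, by_contra fun hc => h (if_neg hc)⟩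
  · rw [Matrix.blockDiagonal'_apply_ne _ _ _ hik] at h
    simp [hik] at h

theorem commute_diagPart_nilPart (D : JordanDecomp M) : Commute D.diagPart D.nilPart := by
  ext x y
  rw [diagPart, Matrix.diagonal_mul, Matrix.mul_diagonal]
  by_cases h : D.nilPart x y = 0
  · simp [h]
  · rw [(D.nilPart_apply_ne_zero h).1, mul_comm]

/-- A nonzero entry of the nilpotent part advances the position inside a block by exactly one, so a
nonzero entry of its `k`-th power advances it by `k`, and no block is longer than `maxSize`. -/
theorem nilPart_pow_maxSize (D : JordanDecomp M) : D.nilPart ^ D.maxSize = 0 := by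
  have h : ∀ (k : ℕ) (x y : ι), (D.nilPart ^ k) x y ≠ 0 →
      ((D.e x).2 : ℕ) + k = ((D.e y).2 : ℕ) := by
    intro k
    induction k with
    | zero =>
      intro x y h
      by_cases hxy : x = y
      · subst hxy
        rfl
      · simp [hxy] at h
    | succ k ih =>
      intro x y h
      rw [pow_succ, Matrix.mul_apply] at h
      obtain ⟨w, -, hw⟩ := exists_ne_zero_of_sum_ne_zero h
      have h1 := ih x w (left_ne_zero_of_mul hw)
      have h2 := (D.nilPart_apply_ne_zero (right_ne_zero_of_mul hw)).2
      omega
  ext x y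
  by_contra hc
  have h1 := h _ x y hc
  have h2 : D.size (D.e y).1 ≤ D.maxSize := le_sup (f := D.size) (mem_univ _)
  have h3 := (D.e y).2.isLt
  omega

theorem inv_mul_P (D : JordanDecomp M) : D.P⁻¹ * D.P = 1 :=
  Matrix.nonsing_inv_mul _ ((Matrix.isUnit_iff_isUnit_det _).mp D.isUnit_P)

theorem mul_inv_P (D : JordanDecomp M) : D.P * D.P⁻¹ = 1 :=
  Matrix.mul_nonsing_inv _ ((Matrix.isUnit_iff_isUnit_det _).mp D.isUnit_P)

theorem semiconjBy (D : JordanDecomp M) : SemiconjBy D.P M (D.diagPart + D.nilPart) := by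
  change D.P * M = (D.diagPart + D.nilPart) * D.P
  have h := congrArg (D.P * ·) D.eq
  rw [h, ← mul_assoc, ← mul_assoc, D.mul_inv_P, one_mul, nilPart, add_sub_cancel]

/-- The first coordinate vector of a block is killed by the nilpotent part; `P⁻¹` carries it to an
eigenvector of `M`. Spectral bounds on `M` thereby reach every diagonal entry of the Jordan matrix.
-/
theorem exists_eigenvector (D : JordanDecomp M) (x : ι) :
    ∃ v : ι → ℂ, v ≠ 0 ∧ M.mulVec v = D.eig (D.e x).1 • v := by
  obtain ⟨y, hy1, hy2⟩ : ∃ y, (D.e y).1 = (D.e x).1 ∧ ((D.e y).2 : ℕ) = 0 := by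
    refine ⟨D.e.symm ⟨(D.e x).1, ⟨0, D.size_pos _⟩⟩, ?_, ?_⟩ <;> rw [Equiv.apply_symm_apply]
  have hJ : (D.diagPart + D.nilPart).mulVec (Pi.single y 1) =
      D.eig (D.e x).1 • (Pi.single y 1 : ι → ℂ) := by
    have h0 : D.nilPart.mulVec (Pi.single y 1) = 0 := by
      ext z
      rw [Matrix.mulVec_single_one]
      by_contra hc
      have := (D.nilPart_apply_ne_zero hc).2
      omega
    rw [Matrix.add_mulVec, h0, add_zero, diagPart, Matrix.mulVec_single_one]
    ext z
    by_cases hz : z = y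
    · subst hz
      simp [hy1]
    · simp [hz]
  refine ⟨D.P⁻¹.mulVec (Pi.single y 1), fun h => ?_, ?_⟩
  · have h2 := congrArg D.P.mulVec h
    rw [Matrix.mulVec_mulVec, D.mul_inv_P, Matrix.one_mulVec, Matrix.mulVec_zero] at h2
    have := congrFun h2 y
    simp at this
  · have h2 : M * D.P⁻¹ = D.P⁻¹ * (D.diagPart + D.nilPart) := by
      calc M * D.P⁻¹ = D.P⁻¹ * (D.P * M) * D.P⁻¹ := by rw [← mul_assoc, D.inv_mul_P, one_mul]
        _ = _ := by rw [D.semiconjBy.eq, mul_assoc, mul_assoc, D.mul_inv_P, mul_one]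
    rw [Matrix.mulVec_mulVec, h2, ← Matrix.mulVec_mulVec, hJ, Matrix.mulVec_smul]

theorem maxSize_pos [Nonempty ι] (D : JordanDecomp M) : 0 < D.maxSize :=
  let x := Classical.arbitrary ι
  (D.size_pos (D.e x).1).trans_le (le_sup (f := D.size) (mem_univ _))

theorem one_le_condP [Nonempty ι] (D : JordanDecomp M) : 1 ≤ D.condP := by
  calc (1 : ℝ) = ‖D.P * D.P⁻¹‖ := by rw [D.mul_inv_P, CStarRing.norm_one]
    _ ≤ _ := norm_mul_le _ _

theorem norm_eigenvalue_le {l : ℂ} {v : ι → ℂ} (hv : v ≠ 0) (h : M.mulVec v = l • v) :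
    ‖l‖ ≤ ‖M‖ := by
  have h1 := Matrix.l2_opNorm_mulVec M (WithLp.toLp 2 v)
  have h2 : ‖(WithLp.toLp 2 (l • v) : EuclideanSpace ℂ ι)‖ =
      ‖l‖ * ‖(WithLp.toLp 2 v : EuclideanSpace ℂ ι)‖ := by
    rw [WithLp.toLp_smul, norm_smul]
  have h3 : 0 < ‖(WithLp.toLp 2 v : EuclideanSpace ℂ ι)‖ := by
    rw [norm_pos_iff]
    simpa using hv
  refine le_of_mul_le_mul_right ?_ h3
  rw [← h2, ← h]
  exact h1

/-- Power bound for `1 + η M` (`ν = 0`) and `1 + η M + η² M²` (`ν = 1`). -/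
theorem norm_one_add_pow_le [Nonempty ι] (D : JordanDecomp M) {η ν : ℂ} {ρ d q : ℝ}
    (hd : ∀ l, (∃ v : ι → ℂ, v ≠ 0 ∧ M.mulVec v = l • v) → ‖η * l + ν * (η * l) ^ 2‖ ≤ d)
    (hρ : ∀ l, (∃ v : ι → ℂ, v ≠ 0 ∧ M.mulVec v = l • v) → ‖1 + (η * l + ν * (η * l) ^ 2)‖ ≤ ρ)
    (hq : ‖η • M + ν • (η • M) ^ 2‖ ≤ q) (hdq : d + q ≤ 1) (T : ℕ) :
    ‖(1 + (η • M + ν • (η • M) ^ 2)) ^ T‖ ≤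
      D.condP * ∑ j ∈ range D.maxSize, (T.choose j : ℝ) * ρ ^ (T - j) := by
  set Λ := D.diagPart
  set N := D.nilPart
  have hΛN : Commute Λ N := D.commute_diagPart_nilPart
  have hsm : ∀ (c : ℂ) {X Y : Matrix ι ι ℂ}, SemiconjBy D.P X Y → SemiconjBy D.P (c • X) (c • Y) := by
    intro c X Y h
    change D.P * (c • X) = (c • Y) * D.P
    rw [mul_smul_comm, h.eq, smul_mul_assoc]
  have hdiag : η • Λ + ν • (η • Λ) ^ 2 =
      Matrix.diagonal fun x => η * D.eig (D.e x).1 + ν * (η * D.eig (D.e x).1) ^ 2 := by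
    simp only [Λ, diagPart]
    rw [← Matrix.diagonal_smul, Matrix.diagonal_pow, ← Matrix.diagonal_smul, Matrix.diagonal_add]
    rfl
  have hη : Commute (η • Λ) (η • N) := (hΛN.smul_left η).smul_right η
  -- A polynomial in `Λ + N` equals the same polynomial in `Λ` plus a multiple of `N`; `R` is the
  -- cofactor. It commutes with `Λ` and `N`, so the new nilpotent part has the same nilpotency
  -- bound.
  set R := (1 : Matrix ι ι ℂ) + ν • ((2 : ℂ) • (η • Λ) + η • N) with hR
  have hsplit : η • (Λ + N) + ν • (η • (Λ + N)) ^ 2 =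
      (η • Λ + ν • (η • Λ) ^ 2) + (η • N) * R := by
    have h : (η • Λ + η • N) ^ 2 = (η • Λ) ^ 2 + (η • N) * ((2 : ℂ) • (η • Λ) + η • N) := by
      generalize η • Λ = a at hη ⊢
      generalize η • N = b at hη ⊢
      simp only [sq, mul_add, add_mul, two_smul, hη.eq]
      abel
    rw [smul_add, h, hR, mul_add (η • N) 1, mul_one, mul_smul_comm, smul_add]
    abel
  have hNR : Commute (η • N) R :=
    (Commute.one_right _).add_right (((hη.symm.smul_right 2).add_right (Commute.refl _)).smul_right ν)
  have hΛR : Commute (η • Λ) R :=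
    (Commute.one_right _).add_right ((((Commute.refl _).smul_right 2).add_right hη).smul_right ν)
  refine norm_one_add_pow_le_of_semiconjBy (D := η • Λ + ν • (η • Λ) ^ 2) (G := (η • N) * R)
    D.inv_mul_P ?_ ?_ ?_ ?_ ?_ T
  · rw [← hsplit]
    have h := hsm η D.semiconjBy
    exact h.add_right (hsm ν (h.pow_right 2))
  · have h : Commute (η • Λ) ((η • N) * R) := hη.mul_right hΛR
    exact h.add_left ((h.pow_left 2).smul_left ν)
  · rw [hNR.mul_pow, smul_pow, D.nilPart_pow_maxSize, smul_zero, zero_mul]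
  · have h : ‖η • Λ + ν • (η • Λ) ^ 2‖ ≤ d := by
      rw [hdiag, Matrix.l2_opNorm_diagonal, pi_norm_le_iff_of_nonempty]
      exact fun x => hd _ (D.exists_eigenvector x)
    linarith
  · rw [hdiag, ← Matrix.diagonal_one, Matrix.diagonal_add, Matrix.l2_opNorm_diagonal,
      pi_norm_le_iff_of_nonempty]
    exact fun x => hρ _ (D.exists_eigenvector x)

end Minimax.JordanDecomp

end

/-! ### Quadratic-form estimates. -/

section

open Finset Matrix

namespace Matrix

theorem dotProduct_self_eq_norm_sq {ι : Type*} [Fintype ι] (x : ι → ℝ) :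
    x ⬝ᵥ x = ‖(WithLp.toLp 2 x : EuclideanSpace ℝ ι)‖ ^ 2 := by
  rw [EuclideanSpace.norm_sq_eq]
  simp [dotProduct, sq]

theorem mulVec_dotProduct_self_le {ι κ : Type*} [Fintype ι] [Fintype κ] [DecidableEq ι]
    {B : Matrix κ ι ℝ} {L : ℝ} (hB : ‖B‖ ≤ L) (x : ι → ℝ) :
    B *ᵥ x ⬝ᵥ B *ᵥ x ≤ L ^ 2 * (x ⬝ᵥ x) := by
  rw [dotProduct_self_eq_norm_sq, dotProduct_self_eq_norm_sq, ← mul_pow]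
  have h := B.l2_opNorm_mulVec (WithLp.toLp 2 x)
  refine pow_le_pow_left₀ (norm_nonneg _) ?_ 2
  exact h.trans (mul_le_mul_of_nonneg_right hB (norm_nonneg _))

theorem neg_mul_le_dotProduct_mulVec {ι : Type*} [Fintype ι] [DecidableEq ι]
    {C : Matrix ι ι ℝ} {L : ℝ} (hC : ‖C‖ ≤ L) (x : ι → ℝ) :
    -(L * (x ⬝ᵥ x)) ≤ x ⬝ᵥ C *ᵥ x := by
  have h1 := abs_le.mp (abs_real_inner_le_norm (WithLp.toLp 2 x : EuclideanSpace ℝ ι)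
    (WithLp.toLp 2 (C *ᵥ x)))
  have h2 : inner ℝ (WithLp.toLp 2 x : EuclideanSpace ℝ ι) (WithLp.toLp 2 (C *ᵥ x)) =
      x ⬝ᵥ C *ᵥ x := by
    rw [EuclideanSpace.inner_toLp_toLp, star_trivial, dotProduct_comm]
  have h3 : ‖(WithLp.toLp 2 (C *ᵥ x) : EuclideanSpace ℝ ι)‖ ≤
      L * ‖(WithLp.toLp 2 x : EuclideanSpace ℝ ι)‖ :=
    (C.l2_opNorm_mulVec (WithLp.toLp 2 x)).trans (mul_le_mul_of_nonneg_right hC (norm_nonneg _))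
  rw [h2] at h1
  rw [dotProduct_self_eq_norm_sq]
  nlinarith [h1.1, mul_le_mul_of_nonneg_left h3
    (norm_nonneg (WithLp.toLp 2 x : EuclideanSpace ℝ ι))]

theorem IsSymm.dotProduct_mulVec_comm {ι : Type*} [Fintype ι] {A : Matrix ι ι ℝ} (hA : A.IsSymm)
    (x y : ι → ℝ) : x ⬝ᵥ A *ᵥ y = y ⬝ᵥ A *ᵥ x := by
  conv_lhs => rw [← hA.eq]
  exact dotProduct_transpose_mulVec _ _ _

theorem PosSemidef.mul_le_dotProduct_mulVec {ι : Type*} [Fintype ι] [DecidableEq ι]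
    {A : Matrix ι ι ℝ} {μ : ℝ} (h : (A - μ • (1 : Matrix ι ι ℝ)).PosSemidef) (x : ι → ℝ) :
    μ * (x ⬝ᵥ x) ≤ x ⬝ᵥ A *ᵥ x := by
  have := h.dotProduct_mulVec_nonneg x
  simp only [star_trivial, sub_mulVec, smul_mulVec, one_mulVec, dotProduct_sub, dotProduct_smul,
    smul_eq_mul] at this
  linarith

theorem PosSemidef.dotProduct_mulVec_le_mul {ι : Type*} [Fintype ι] [DecidableEq ι]
    {A : Matrix ι ι ℝ} {μ : ℝ} (h : (μ • (1 : Matrix ι ι ℝ) - A).PosSemidef) (x : ι → ℝ) :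
    x ⬝ᵥ A *ᵥ x ≤ μ * (x ⬝ᵥ x) := by
  have := h.dotProduct_mulVec_nonneg x
  simp only [star_trivial, sub_mulVec, smul_mulVec, one_mulVec, dotProduct_sub, dotProduct_smul,
    smul_eq_mul] at this
  linarith

theorem real_dotProduct_self_nonneg {ι : Type*} [Fintype ι] (x : ι → ℝ) : 0 ≤ x ⬝ᵥ x := by
  rw [dotProduct_self_eq_norm_sq]
  positivity

theorem add_dotProduct_self_le {ι : Type*} [Fintype ι] (x y : ι → ℝ) :
    (x + y) ⬝ᵥ (x + y) ≤ 2 * (x ⬝ᵥ x) + 2 * (y ⬝ᵥ y) := by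
  have := real_dotProduct_self_nonneg (x - y)
  simp only [add_dotProduct, dotProduct_add, sub_dotProduct, dotProduct_sub] at this ⊢
  linarith

/-- A real matrix acts separately on real and imaginary parts, and the squared norms add. -/
theorem norm_map_ofReal_le {ι : Type*} [Fintype ι] [DecidableEq ι] {M : Matrix ι ι ℝ} {K : ℝ}
    (hK : 0 ≤ K) (h : ∀ x : ι → ℝ, M *ᵥ x ⬝ᵥ M *ᵥ x ≤ K ^ 2 * (x ⬝ᵥ x)) :
    ‖M.map Complex.ofReal‖ ≤ K := by
  rw [l2_opNorm_def]
  refine ContinuousLinearMap.opNorm_le_bound _ hK fun z => ?_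
  have hz : ∀ w : ι → ℂ, ‖(WithLp.toLp 2 w : EuclideanSpace ℂ ι)‖ ^ 2 =
      (fun i => (w i).re) ⬝ᵥ (fun i => (w i).re) + (fun i => (w i).im) ⬝ᵥ (fun i => (w i).im) := by
    intro w
    rw [EuclideanSpace.norm_sq_eq]
    simp only [dotProduct, ← sum_add_distrib, Complex.sq_norm, Complex.normSq_apply]
  refine abs_le_of_sq_le_sq' ?_ (by positivity) |>.2
  change ‖(WithLp.toLp 2 (M.map Complex.ofReal *ᵥ z.ofLp) : EuclideanSpace ℂ ι)‖ ^ 2 ≤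
    (K * ‖(WithLp.toLp 2 z.ofLp : EuclideanSpace ℂ ι)‖) ^ 2
  rw [mul_pow, hz, hz]
  have hre : (fun i => ((M.map Complex.ofReal *ᵥ z.ofLp) i).re) = M *ᵥ fun i => (z.ofLp i).re := by
    ext i
    simp [mulVec, dotProduct]
  have him : (fun i => ((M.map Complex.ofReal *ᵥ z.ofLp) i).im) = M *ᵥ fun i => (z.ofLp i).im := by
    ext i
    simp [mulVec, dotProduct]
  rw [hre, him, mul_add]
  exact add_le_add (h _) (h _)

end Matrix

/-! ### Norm and spectrum of the matrix of the dynamics. -/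

namespace Minimax.QuadAssumption

variable {n m : ℕ} {A : Matrix (Fin m) (Fin m) ℝ} {B : Matrix (Fin n) (Fin m) ℝ}
  {C : Matrix (Fin n) (Fin n) ℝ} {L μ μx : ℝ}

theorem mu_le_L (h : QuadAssumption A B C L μ μx) (hm : 0 < m) : μ ≤ L := by
  have h1 := h.mu_le.mul_le_dotProduct_mulVec (Pi.single ⟨0, hm⟩ 1)
  have h2 := h.le_L.dotProduct_mulVec_le_mul (Pi.single ⟨0, hm⟩ 1)
  have h3 := h1.trans h2
  simpa using h3

/-- Testing `A ≥ 0` on `Lv - Av` and `A ≤ L` on `Av` gives `‖Av‖² ≤ L vᵀAv`, without diagonalizing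
`A`. -/
theorem mulVec_A_dotProduct_self_le (h : QuadAssumption A B C L μ μx) (hL : 0 < L)
    (v : Fin m → ℝ) : A *ᵥ v ⬝ᵥ A *ᵥ v ≤ L ^ 2 * (v ⬝ᵥ v) := by
  have h1 := h.mu_le.mul_le_dotProduct_mulVec (L • v - A *ᵥ v)
  have h2 := h.le_L.dotProduct_mulVec_le_mul (A *ᵥ v)
  have h3 := h.le_L.dotProduct_mulVec_le_mul v
  have h4 := mul_nonneg h.mu_pos.le (real_dotProduct_self_nonneg (L • v - A *ᵥ v))
  have h5 := h.symm_A.dotProduct_mulVec_comm v (A *ᵥ v)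
  have h7 : 0 ≤ L * (L * (v ⬝ᵥ A *ᵥ v) - A *ᵥ v ⬝ᵥ A *ᵥ v) := by
    have := h4.trans h1
    simp only [mulVec_sub, mulVec_smul, sub_dotProduct, dotProduct_sub, smul_dotProduct,
      dotProduct_smul, smul_eq_mul] at this
    nlinarith
  have h8 := nonneg_of_mul_nonneg_right h7 hL
  nlinarith

theorem norm_dynMatrix_le (h : QuadAssumption A B C L μ μx) (hL : 0 < L) {r : ℝ} (hr : 2 ≤ r) :
    ‖(dynMatrix A B C r).map Complex.ofReal‖ ≤ 8 / 5 * (r * L) := by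
  refine norm_map_ofReal_le (by positivity) fun w => ?_
  set x := w ∘ Sum.inl with hx
  set y := w ∘ Sum.inr with hy
  have hw : w = Sum.elim x y := (Sum.elim_comp_inl_inr w).symm
  have hBt : ‖Bᵀ‖ ≤ L := by
    rw [← conjTranspose_eq_transpose_of_trivial, l2_opNorm_conjTranspose]
    exact h.norm_B
  have h1 : dynMatrix A B C r *ᵥ w =
      Sum.elim (-(C *ᵥ x + B *ᵥ y)) (r • (Bᵀ *ᵥ x + -(A *ᵥ y))) := by
    rw [dynMatrix, fromBlocks_mulVec]
    simp only [neg_mulVec, smul_mulVec, smul_add, smul_neg, neg_add, ← hx, ← hy]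
  have h2 := add_dotProduct_self_le (C *ᵥ x) (B *ᵥ y)
  have h3 := add_dotProduct_self_le (Bᵀ *ᵥ x) (-(A *ᵥ y))
  rw [neg_dotProduct_neg] at h3
  have h4 := mulVec_dotProduct_self_le h.norm_C x
  have h5 := mulVec_dotProduct_self_le h.norm_B y
  have h6 := mulVec_dotProduct_self_le hBt x
  have h7 := h.mulVec_A_dotProduct_self_le hL y
  rw [h1]
  conv_rhs => rw [hw]
  rw [sumElim_dotProduct_sumElim, sumElim_dotProduct_sumElim, neg_dotProduct_neg, smul_dotProduct,
    dotProduct_smul, smul_eq_mul, smul_eq_mul]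
  have h8 := real_dotProduct_self_nonneg x
  have h9 := real_dotProduct_self_nonneg y
  set S := x ⬝ᵥ x + y ⬝ᵥ y with hS
  have h10 : (C *ᵥ x + B *ᵥ y) ⬝ᵥ (C *ᵥ x + B *ᵥ y) ≤ 2 * L ^ 2 * S := by rw [hS]; linarith
  have h11 : (Bᵀ *ᵥ x + -(A *ᵥ y)) ⬝ᵥ (Bᵀ *ᵥ x + -(A *ᵥ y)) ≤ 2 * L ^ 2 * S := by
    rw [hS]; linarith
  have h12 : r * (r * ((Bᵀ *ᵥ x + -(A *ᵥ y)) ⬝ᵥ (Bᵀ *ᵥ x + -(A *ᵥ y)))) ≤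
      r ^ 2 * (2 * L ^ 2 * S) := by
    rw [← mul_assoc, ← sq]
    gcongr
  -- As `r ≥ 2`, `2(1 + r²) ≤ (5/2) r² ≤ (8/5)² r²`.
  have h13 : 2 * L ^ 2 * S + r ^ 2 * (2 * L ^ 2 * S) ≤ (8 / 5 * (r * L)) ^ 2 * S := by
    have : 0 ≤ L ^ 2 * S := by positivity
    nlinarith [mul_le_mul_of_nonneg_right (show (4 : ℝ) ≤ r ^ 2 by nlinarith) this]
  linarith

/-- Real eigenvalues of the matrix of the dynamics are at most `-μₓ`. -/
theorem real_eigenvalue_le (h : QuadAssumption A B C L μ μx) {r α : ℝ} (hr0 : 0 < r)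
    (hr : 2 * L ≤ r * μ) {u : Fin n → ℝ} {v : Fin m → ℝ} (huv : u ⬝ᵥ u + v ⬝ᵥ v ≠ 0)
    (h1 : -(C *ᵥ u + B *ᵥ v) = α • u) (h2 : r • (Bᵀ *ᵥ u - A *ᵥ v) = α • v) : α ≤ -μx := by
  by_contra! hα
  have hμ := h.mu_pos
  have hμx := h.mux_pos
  have hxL := h.mux_le_L
  obtain ⟨t, rfl⟩ : ∃ t, α = r * t := ⟨α / r, by field_simp⟩
  have hdet : IsUnit A.det := by
    rw [isUnit_iff_ne_zero]
    intro hc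
    obtain ⟨w, hw0, hw⟩ := exists_mulVec_eq_zero_iff.mpr hc
    have k := h.mu_le.mul_le_dotProduct_mulVec w
    rw [hw, dotProduct_zero] at k
    exact hw0 (dotProduct_self_eq_zero.mp
      (le_antisymm (nonpos_of_mul_nonpos_right k hμ) (real_dotProduct_self_nonneg w)))
  have hBu : Bᵀ *ᵥ u = A *ᵥ v + t • v := by
    rw [mul_smul] at h2
    have := smul_right_injective (Fin m → ℝ) hr0.ne' h2
    rw [← this]
    abel
  set z := A⁻¹ *ᵥ v with hz
  have hAz : A *ᵥ z = v := by
    rw [hz, mulVec_mulVec, mul_nonsing_inv _ hdet, one_mulVec]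
  have hAv : A⁻¹ *ᵥ (A *ᵥ v) = v := by rw [mulVec_mulVec, nonsing_inv_mul _ hdet, one_mulVec]
  have hu := real_dotProduct_self_nonneg u
  have hv := real_dotProduct_self_nonneg v
  have e1 : u ⬝ᵥ C *ᵥ u + u ⬝ᵥ B *ᵥ v = -(r * t) * (u ⬝ᵥ u) := by
    have := congrArg (u ⬝ᵥ ·) h1
    simp only [dotProduct_neg, dotProduct_add, dotProduct_smul, smul_eq_mul] at this
    linarith
  have e2 : u ⬝ᵥ B *ᵥ v = v ⬝ᵥ A *ᵥ v + t * (v ⬝ᵥ v) := by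
    rw [← dotProduct_transpose_mulVec, hBu, dotProduct_add, dotProduct_smul, smul_eq_mul]
  have hzz : v ⬝ᵥ z = z ⬝ᵥ A *ᵥ z := by rw [hAz, dotProduct_comm]
  have hzv : μ * (v ⬝ᵥ z) ≤ v ⬝ᵥ v := by
    have k1 := h.mu_le.mul_le_dotProduct_mulVec z
    have k2 := real_dotProduct_self_nonneg (v - μ • z)
    rw [← hzz] at k1
    simp only [sub_dotProduct, dotProduct_sub, smul_dotProduct, dotProduct_smul, smul_eq_mul,
      dotProduct_comm z v] at k2
    nlinarith
  -- Since `Bᵀu = (A + t)v`, the form is `vᵀ(A + t)A⁻¹(A + t)v`.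
  have hschur : u ⬝ᵥ (B * A⁻¹ * Bᵀ) *ᵥ u = v ⬝ᵥ A *ᵥ v + 2 * t * (v ⬝ᵥ v) + t ^ 2 * (v ⬝ᵥ z) := by
    rw [← mulVec_mulVec, ← mulVec_mulVec, ← dotProduct_transpose_mulVec, hBu, mulVec_add,
      mulVec_smul, hAv, dotProduct_comm, ← hz]
    have : A *ᵥ v ⬝ᵥ z = v ⬝ᵥ v := by
      rw [dotProduct_comm, h.symm_A.dotProduct_mulVec_comm, hAz]
    simp only [add_dotProduct, dotProduct_add, smul_dotProduct, dotProduct_smul, smul_eq_mul, this,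
      dotProduct_comm (A *ᵥ v) v]
    ring
  have hmain := h.mux_le.mul_le_dotProduct_mulVec u
  rw [add_mulVec, dotProduct_add, hschur] at hmain
  have hvA := h.mu_le.mul_le_dotProduct_mulVec v
  have hC := neg_mul_le_dotProduct_mulVec h.norm_C u
  have key : (μx + r * t) * (u ⬝ᵥ u) ≤ t * (v ⬝ᵥ v) + t ^ 2 * (v ⬝ᵥ z) := by nlinarith
  have ht : -μ < t := by
    by_contra! hc
    nlinarith [mul_le_mul_of_nonneg_left hc hr0.le]
  have key2 : μ * (μx + r * t) * (u ⬝ᵥ u) ≤ t * (μ + t) * (v ⬝ᵥ v) := by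
    nlinarith [mul_le_mul_of_nonneg_left key hμ.le, mul_le_mul_of_nonneg_left hzv (sq_nonneg t)]
  have hpos : 0 ≤ μ * (μx + r * t) * (u ⬝ᵥ u) := by
    have : 0 < μx + r * t := by linarith
    positivity
  have hv3 : (μ + t) * (v ⬝ᵥ v) ≤ (L - r * t) * (u ⬝ᵥ u) := by linarith
  -- If `u = 0`, `hv3` forces `v = 0`. Otherwise the left side of `key2` is positive: for `-μ < t ≤
  -- 0` its right side is nonpositive, and for `t > 0` `hv3` bounds that side by `tL‖u‖²`, while the
  -- left side exceeds `rμt‖u‖² ≥ 2Lt‖u‖²`.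
  rcases hu.eq_or_lt with hu0 | hu0
  · rw [← hu0] at hv3 huv
    have : 0 < v ⬝ᵥ v := lt_of_le_of_ne hv (by simpa using huv.symm)
    nlinarith [mul_pos (show 0 < μ + t by linarith) this]
  · have hpos' : 0 < μ * (μx + r * t) * (u ⬝ᵥ u) := by
      have : 0 < μx + r * t := by linarith
      positivity
    rcases le_or_gt t 0 with ht0 | ht0
    · have : t * (μ + t) * (v ⬝ᵥ v) ≤ 0 :=
        mul_nonpos_of_nonpos_of_nonneg (mul_nonpos_of_nonpos_of_nonneg ht0 (by linarith)) hv
      linarith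
    · have k1 : t * (μ + t) * (v ⬝ᵥ v) ≤ t * L * (u ⬝ᵥ u) := by
        have := mul_le_mul_of_nonneg_left hv3 ht0.le
        have : 0 ≤ t * (r * t) * (u ⬝ᵥ u) := by positivity
        linarith
      have k2 : 0 ≤ (r * μ - 2 * L) * (t * (u ⬝ᵥ u)) := mul_nonneg (by linarith) (by positivity)
      have k3 : 0 < μ * μx * (u ⬝ᵥ u) := by positivity
      have k4 : 0 < L * (t * (u ⬝ᵥ u)) := by
        have : 0 < L := hμx.trans_le hxL
        positivity
      linarith

/-- Non-real eigenvalues `α + iβ` of the matrix of the dynamics satisfy `α ≤ -L/2` and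
`β² ≤ r L²`. -/
theorem nonreal_eigenvalue_bounds (h : QuadAssumption A B C L μ μx) {r α β : ℝ} (hr0 : 0 < r)
    (hr : 2 * L ≤ r * μ) (hβ : β ≠ 0) {u₁ u₂ : Fin n → ℝ} {v₁ v₂ : Fin m → ℝ}
    (hne : u₁ ⬝ᵥ u₁ + v₁ ⬝ᵥ v₁ + (u₂ ⬝ᵥ u₂ + v₂ ⬝ᵥ v₂) ≠ 0)
    (h1 : -(C *ᵥ u₁ + B *ᵥ v₁) = α • u₁ - β • u₂) (h2 : r • (Bᵀ *ᵥ u₁ - A *ᵥ v₁) = α • v₁ - β • v₂)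
    (h3 : -(C *ᵥ u₂ + B *ᵥ v₂) = α • u₂ + β • u₁)
    (h4 : r • (Bᵀ *ᵥ u₂ - A *ᵥ v₂) = α • v₂ + β • v₁) :
    α ≤ -(L / 2) ∧ β ^ 2 ≤ r * L ^ 2 := by
  have hBt : ‖Bᵀ‖ ≤ L := by
    rw [← conjTranspose_eq_transpose_of_trivial, l2_opNorm_conjTranspose]
    exact h.norm_B
  have a11 := congrArg (u₁ ⬝ᵥ ·) h1
  have a12 := congrArg (u₂ ⬝ᵥ ·) h1
  have a21 := congrArg (v₁ ⬝ᵥ ·) h2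
  have a22 := congrArg (v₂ ⬝ᵥ ·) h2
  have a31 := congrArg (u₁ ⬝ᵥ ·) h3
  have a32 := congrArg (u₂ ⬝ᵥ ·) h3
  have a41 := congrArg (v₁ ⬝ᵥ ·) h4
  have a42 := congrArg (v₂ ⬝ᵥ ·) h4
  simp only [dotProduct_neg, dotProduct_add, dotProduct_sub, dotProduct_smul, smul_eq_mul,
    dotProduct_transpose_mulVec, dotProduct_comm u₂ u₁, dotProduct_comm v₂ v₁,
    h.symm_C.dotProduct_mulVec_comm u₂ u₁, h.symm_A.dotProduct_mulVec_comm v₂ v₁]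
    at a11 a12 a21 a22 a31 a32 a41 a42
  have nu₁ := real_dotProduct_self_nonneg u₁
  have nu₂ := real_dotProduct_self_nonneg u₂
  have nv₁ := real_dotProduct_self_nonneg v₁
  have nv₂ := real_dotProduct_self_nonneg v₂
  set U := u₁ ⬝ᵥ u₁ + u₂ ⬝ᵥ u₂ with hU
  set V := v₁ ⬝ᵥ v₁ + v₂ ⬝ᵥ v₂ with hV
  have hS : u₁ ⬝ᵥ B *ᵥ v₂ - u₂ ⬝ᵥ B *ᵥ v₁ = -(β * U) := by rw [hU]; linarith
  have hS' : r * (u₁ ⬝ᵥ B *ᵥ v₂ - u₂ ⬝ᵥ B *ᵥ v₁) = -(β * V) := by rw [hV]; linarith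
  -- The coupling through `B` enters the two block equations with opposite signs; comparing
  -- imaginary parts and cancelling `β ≠ 0` fixes the ratio of the two masses.
  have hVU : V = r * U := by
    rw [hS] at hS'
    apply mul_left_cancel₀ hβ
    linarith
  have hUpos : 0 < U := by
    rcases (add_nonneg nu₁ nu₂).eq_or_lt with h0 | h0
    · exfalso
      rw [← hU] at h0
      rw [← h0, mul_zero] at hVU
      apply hne
      linarith
    · exact h0
  have hC₁ := neg_mul_le_dotProduct_mulVec h.norm_C u₁
  have hC₂ := neg_mul_le_dotProduct_mulVec h.norm_C u₂
  have hA₁ := h.mu_le.mul_le_dotProduct_mulVec v₁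
  have hA₂ := h.mu_le.mul_le_dotProduct_mulVec v₂
  constructor
  -- In the real parts the coupling cancels, leaving `2αU = -u*Cu - v*Av ≤ (L - rμ)U ≤ -LU`.
  · have e : r * (2 * α * U + (u₁ ⬝ᵥ C *ᵥ u₁ + u₂ ⬝ᵥ C *ᵥ u₂) +
        (v₁ ⬝ᵥ A *ᵥ v₁ + v₂ ⬝ᵥ A *ᵥ v₂)) = 0 := by
      have : r * (α * U) = α * V := by rw [hVU]; ring
      linear_combination r * a11 * (-1) + r * a32 * (-1) - a21 - a42 + this + r * α * hU - α * hV
    have e' := (mul_eq_zero.mp e).resolve_left hr0.ne'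
    have k : μ * V ≤ v₁ ⬝ᵥ A *ᵥ v₁ + v₂ ⬝ᵥ A *ᵥ v₂ := by rw [hV]; linarith
    have k' : -(L * U) ≤ u₁ ⬝ᵥ C *ᵥ u₁ + u₂ ⬝ᵥ C *ᵥ u₂ := by rw [hU]; linarith
    have k2 : 0 ≤ (r * μ - 2 * L) * U := mul_nonneg (by linarith) hUpos.le
    rw [hVU] at k
    refine le_of_mul_le_mul_right ?_ hUpos
    linarith
  · have b₁ := mulVec_dotProduct_self_le hBt u₁
    have b₂ := mulVec_dotProduct_self_le hBt u₂
    -- Cauchy–Schwarz for `|β| U ≤ L √U √V`, obtained by completing squares; `k = β/r` is the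
    -- optimal weight because `V = rU`.
    obtain ⟨k, rfl⟩ : ∃ k, β = r * k := ⟨β / r, by field_simp⟩
    have q₁ := real_dotProduct_self_nonneg (Bᵀ *ᵥ u₁ + k • v₂)
    have q₂ := real_dotProduct_self_nonneg (Bᵀ *ᵥ u₂ - k • v₁)
    have c₁ : v₂ ⬝ᵥ Bᵀ *ᵥ u₁ = u₁ ⬝ᵥ B *ᵥ v₂ := dotProduct_transpose_mulVec _ _ _
    have c₂ : v₁ ⬝ᵥ Bᵀ *ᵥ u₂ = u₂ ⬝ᵥ B *ᵥ v₁ := dotProduct_transpose_mulVec _ _ _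
    rw [add_dotProduct, dotProduct_add, dotProduct_add, smul_dotProduct, smul_dotProduct,
      dotProduct_smul, dotProduct_smul, dotProduct_comm (Bᵀ *ᵥ u₁) v₂, c₁] at q₁
    rw [sub_dotProduct, dotProduct_sub, dotProduct_sub, smul_dotProduct, smul_dotProduct,
      dotProduct_smul, dotProduct_smul, dotProduct_comm (Bᵀ *ᵥ u₂) v₁, c₂] at q₂
    simp only [smul_eq_mul] at q₁ q₂
    have e : k ^ 2 * V = k ^ 2 * r * U := by rw [hVU]; ring
    have hS2 : k * (u₁ ⬝ᵥ B *ᵥ v₂ - u₂ ⬝ᵥ B *ᵥ v₁) = k * -(r * k * U) := by rw [hS]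
    have f : k ^ 2 * r * U ≤ L ^ 2 * U := by
      rw [hU] at hS2 ⊢
      rw [hU, hV] at e
      linarith
    have f' := le_of_mul_le_mul_right f hUpos
    nlinarith [mul_le_mul_of_nonneg_left f' hr0.le]

end Minimax.QuadAssumption

/-! ### Gradients, the linear recursion, and the multipliers. -/

namespace Minimax

theorem hasGradientAt_quadratic_form {ι : Type*} [Fintype ι] [DecidableEq ι] {S : Matrix ι ι ℝ}
    (hS : S.IsSymm) (s : EuclideanSpace ℝ ι) (b : ι → ℝ) (c : ℝ) (x : EuclideanSpace ℝ ι) :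
    HasGradientAt (fun x : EuclideanSpace ℝ ι =>
        1 / 2 * ((x - s).ofLp ⬝ᵥ S *ᵥ (x - s).ofLp) + (x - s).ofLp ⬝ᵥ b + c)
      (WithLp.toLp 2 (S *ᵥ (x - s).ofLp + b)) x := by
  have hf : (fun x : EuclideanSpace ℝ ι =>
        1 / 2 * ((x - s).ofLp ⬝ᵥ S *ᵥ (x - s).ofLp) + (x - s).ofLp ⬝ᵥ b + c) =
      fun x => 1 / 2 * inner ℝ (x - s) (toEuclideanCLM (𝕜 := ℝ) S (x - s)) +
        inner ℝ (x - s) (WithLp.toLp 2 b) + c := by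
    ext x
    rw [inner_toEuclideanCLM, EuclideanSpace.inner_eq_star_dotProduct, star_trivial,
      dotProduct_comm b]
  rw [hf, hasGradientAt_iff_hasFDerivAt]
  have h1 : HasFDerivAt (fun x : EuclideanSpace ℝ ι => x - s)
    (ContinuousLinearMap.id ℝ (EuclideanSpace ℝ ι)) x := (hasFDerivAt_id x).sub_const s
  have h2 := (toEuclideanCLM (𝕜 := ℝ) S).hasFDerivAt.comp x h1
  have h3 := (((h1.inner ℝ h2).const_mul (1 / 2)).add
    (h1.inner ℝ (hasFDerivAt_const (WithLp.toLp 2 b) x))).add_const c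
  refine h3.congr_fderiv ?_
  ext h
  have e1 : inner ℝ (x - s) (toEuclideanCLM (𝕜 := ℝ) S h) =
      inner ℝ h (toEuclideanCLM (𝕜 := ℝ) S (x - s)) := by
    rw [inner_toEuclideanCLM, inner_toEuclideanCLM, hS.dotProduct_mulVec_comm]
  have e2 : inner ℝ (WithLp.toLp 2 (S *ᵥ (x - s).ofLp + b)) h =
      inner ℝ h (toEuclideanCLM (𝕜 := ℝ) S (x - s)) + inner ℝ h (WithLp.toLp 2 b) := by
    rw [← inner_add_right, real_inner_comm]
    rfl
  rw [InnerProductSpace.toDual_apply_apply, e2]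
  simp only [fderivInnerCLM_apply, _root_.add_apply, _root_.smul_apply,
    ContinuousLinearMap.comp_apply, ContinuousLinearMap.prod_apply, ContinuousLinearMap.id_apply,
    _root_.zero_apply, Function.comp_apply, e1, inner_zero_right, smul_eq_mul]
  ring

variable {n m : ℕ} {A : Matrix (Fin m) (Fin m) ℝ} {B : Matrix (Fin n) (Fin m) ℝ}
  {C : Matrix (Fin n) (Fin n) ℝ} {L μ μx : ℝ}

theorem gradX_quadratic (hC : C.IsSymm) (zs z : Pt n m) :
    gradX (quadratic A B C zs) z =
      WithLp.toLp 2 (C *ᵥ (z.fst - zs.fst).ofLp + B *ᵥ (z.snd - zs.snd).ofLp) := by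
  have h := hasGradientAt_quadratic_form hC zs.fst (B *ᵥ (z.snd - zs.snd).ofLp)
    (-(1 / 2) * ((z.snd - zs.snd).ofLp ⬝ᵥ A *ᵥ (z.snd - zs.snd).ofLp)) z.fst
  rw [← h.gradient, gradX]
  congr 1
  ext x
  rw [quadratic]
  ring

theorem gradY_quadratic (hA : A.IsSymm) (zs z : Pt n m) :
    gradY (quadratic A B C zs) z =
      WithLp.toLp 2 (Bᵀ *ᵥ (z.fst - zs.fst).ofLp - A *ᵥ (z.snd - zs.snd).ofLp) := by
  have h := hasGradientAt_quadratic_form hA.neg zs.snd (Bᵀ *ᵥ (z.fst - zs.fst).ofLp)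
    (1 / 2 * ((z.fst - zs.fst).ofLp ⬝ᵥ C *ᵥ (z.fst - zs.fst).ofLp)) z.snd
  rw [neg_mulVec, neg_add_eq_sub] at h
  rw [← h.gradient, gradY]
  congr 1
  ext y
  rw [quadratic, neg_mulVec, dotProduct_neg, dotProduct_transpose_mulVec]
  ring

/-- The coordinates of a point of `ℝⁿ × ℝᵐ` as a complex vector. -/
def complexCoords (z : Pt n m) : Fin n ⊕ Fin m → ℂ :=
  Complex.ofRealHom ∘ Sum.elim z.fst.ofLp z.snd.ofLp

theorem norm_complexCoords (z : Pt n m) :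
    ‖(WithLp.toLp 2 (complexCoords z) : EuclideanSpace ℂ (Fin n ⊕ Fin m))‖ = ‖z‖ := by
  rw [← sq_eq_sq₀ (norm_nonneg _) (norm_nonneg _), WithLp.prod_norm_sq_eq_of_L2,
    EuclideanSpace.norm_sq_eq, EuclideanSpace.norm_sq_eq, EuclideanSpace.norm_sq_eq,
    Fintype.sum_sum_type]
  simp [complexCoords]

theorem complexCoords_step (hA : A.IsSymm) (hC : C.IsSymm) (zs z p : Pt n m) (η r : ℝ) :
    complexCoords (WithLp.toLp 2 (z.fst - η • gradX (quadratic A B C zs) p,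
        z.snd + (r * η) • gradY (quadratic A B C zs) p) - zs : Pt n m) =
      complexCoords (z - zs) +
        ((η : ℂ) • (dynMatrix A B C r).map Complex.ofReal) *ᵥ complexCoords (p - zs) := by
  have h : ((dynMatrix A B C r).map Complex.ofReal) *ᵥ complexCoords (p - zs) =
      Complex.ofRealHom ∘ (dynMatrix A B C r *ᵥ
        Sum.elim (p - zs).fst.ofLp (p - zs).snd.ofLp) := by
    ext i
    exact (RingHom.map_mulVec Complex.ofRealHom _ _ i).symm
  rw [smul_mulVec, h, gradX_quadratic hC, gradY_quadratic hA, dynMatrix, fromBlocks_mulVec]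
  ext i
  rcases i with i | i
  · simp [complexCoords, neg_mulVec]
    ring
  · simp [complexCoords, neg_mulVec, smul_mulVec]
    ring

/-- The coefficient of the quadratic term of one iteration. -/
def Algo.sqCoeff (alg : Algo) : ℂ :=
  match alg with
  | Algo.gda => 0
  | Algo.eg => 1

theorem Algo.complexCoords_iterate (alg : Algo) (hA : A.IsSymm) (hC : C.IsSymm) (zs z : Pt n m)
    {η η' r : ℝ} (hη : η' = r * η) (T : ℕ) :
    complexCoords (alg.iterate (quadratic A B C zs) η η' z T - zs) =
      ((1 + ((η : ℂ) • (dynMatrix A B C r).map Complex.ofReal +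
        alg.sqCoeff • ((η : ℂ) • (dynMatrix A B C r).map Complex.ofReal) ^ 2)) ^ T) *ᵥ
        complexCoords (z - zs) := by
  subst hη
  induction T with
  | zero => simp [Algo.iterate]
  | succ T ih =>
    rw [pow_succ', ← mulVec_mulVec, ← ih, Algo.iterate, Function.iterate_succ_apply',
      ← Algo.iterate]
    generalize alg.iterate (quadratic A B C zs) η (r * η) z T = w
    cases alg
    · rw [Algo.step, gdaStep, complexCoords_step hA hC, Algo.sqCoeff, zero_smul, add_zero,
        add_mulVec, one_mulVec]
    · rw [Algo.step, egStep, complexCoords_step hA hC, gdaStep, complexCoords_step hA hC,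
        Algo.sqCoeff, one_smul, add_mulVec, one_mulVec, add_mulVec, mulVec_add, mulVec_mulVec, sq]

/-- One region covers both kinds of eigenvalue: real ones are at most `-μₓ`, and for the others `-Re
l ≥ L/2` turns `β² ≤ rL²` into the parabolic bound. -/
theorem QuadAssumption.eigenvalue_region (h : QuadAssumption A B C L μ μx) {r : ℝ} (hr0 : 0 < r)
    (hr : 2 * L ≤ r * μ) {l : ℂ} {w : Fin n ⊕ Fin m → ℂ} (hw : w ≠ 0)
    (hl : (dynMatrix A B C r).map Complex.ofReal *ᵥ w = l • w) :
    l.re ≤ -(μx / 2) ∧ l.im ^ 2 ≤ -(2 * r * L * l.re) := by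
  have hx := h.mux_pos
  have hxL := h.mux_le_L
  set u₁ : Fin n → ℝ := fun i => (w (Sum.inl i)).re with hu₁
  set u₂ : Fin n → ℝ := fun i => (w (Sum.inl i)).im with hu₂
  set v₁ : Fin m → ℝ := fun i => (w (Sum.inr i)).re with hv₁
  set v₂ : Fin m → ℝ := fun i => (w (Sum.inr i)).im with hv₂
  have hne : u₁ ⬝ᵥ u₁ + v₁ ⬝ᵥ v₁ + (u₂ ⬝ᵥ u₂ + v₂ ⬝ᵥ v₂) ≠ 0 := by
    intro h0
    have a₁ := real_dotProduct_self_nonneg u₁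
    have a₂ := real_dotProduct_self_nonneg u₂
    have a₃ := real_dotProduct_self_nonneg v₁
    have a₄ := real_dotProduct_self_nonneg v₂
    have b₁ := congrFun (dotProduct_self_eq_zero.mp (show u₁ ⬝ᵥ u₁ = 0 by linarith))
    have b₂ := congrFun (dotProduct_self_eq_zero.mp (show u₂ ⬝ᵥ u₂ = 0 by linarith))
    have b₃ := congrFun (dotProduct_self_eq_zero.mp (show v₁ ⬝ᵥ v₁ = 0 by linarith))
    have b₄ := congrFun (dotProduct_self_eq_zero.mp (show v₂ ⬝ᵥ v₂ = 0 by linarith))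
    apply hw
    ext i
    rcases i with i | i
    · exact Complex.ext (b₁ i) (b₂ i)
    · exact Complex.ext (b₃ i) (b₄ i)
  have hre : dynMatrix A B C r *ᵥ Sum.elim u₁ v₁ =
      Sum.elim (l.re • u₁ - l.im • u₂) (l.re • v₁ - l.im • v₂) := by
    ext i
    have := congrArg Complex.re (congrFun hl i)
    rcases i with i | i <;> simpa [mulVec, dotProduct] using this
  have him : dynMatrix A B C r *ᵥ Sum.elim u₂ v₂ =
      Sum.elim (l.re • u₂ + l.im • u₁) (l.re • v₂ + l.im • v₁) := by
    ext i
    have := congrArg Complex.im (congrFun hl i)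
    rcases i with i | i <;> simpa [mulVec, dotProduct] using this
  rw [dynMatrix, fromBlocks_mulVec, Sum.elim_comp_inl, Sum.elim_comp_inr, Sum.elim_eq_iff] at hre him
  have e₁ : -(C *ᵥ u₁ + B *ᵥ v₁) = l.re • u₁ - l.im • u₂ := by
    rw [← hre.1, neg_mulVec, neg_mulVec, neg_add]
  have e₂ : r • (Bᵀ *ᵥ u₁ - A *ᵥ v₁) = l.re • v₁ - l.im • v₂ := by
    rw [← hre.2, neg_mulVec, smul_mulVec, smul_mulVec, smul_sub, sub_eq_add_neg]
  have e₃ : -(C *ᵥ u₂ + B *ᵥ v₂) = l.re • u₂ + l.im • u₁ := by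
    rw [← him.1, neg_mulVec, neg_mulVec, neg_add]
  have e₄ : r • (Bᵀ *ᵥ u₂ - A *ᵥ v₂) = l.re • v₂ + l.im • v₁ := by
    rw [← him.2, neg_mulVec, smul_mulVec, smul_mulVec, smul_sub, sub_eq_add_neg]
  by_cases hβ : l.im = 0
  · rw [hβ, zero_smul, sub_zero] at e₁ e₂
    rw [hβ, zero_smul, add_zero] at e₃ e₄
    have hle : l.re ≤ -μx := by
      by_cases h1 : u₁ ⬝ᵥ u₁ + v₁ ⬝ᵥ v₁ = 0
      · rw [h1, zero_add] at hne
        exact h.real_eigenvalue_le hr0 hr hne e₃ e₄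
      · exact h.real_eigenvalue_le hr0 hr h1 e₁ e₂
    refine ⟨by linarith, ?_⟩
    have : 0 ≤ r * L * -l.re := mul_nonneg (mul_nonneg hr0.le (by linarith)) (by linarith)
    rw [hβ]
    linarith
  · obtain ⟨k₁, k₂⟩ := h.nonreal_eigenvalue_bounds hr0 hr hβ hne e₁ e₂ e₃ e₄
    refine ⟨by linarith, ?_⟩
    have : r * L * (L / 2) ≤ r * L * -l.re :=
      mul_le_mul_of_nonneg_left (by linarith) (mul_nonneg hr0.le (by linarith))
    linarith

theorem norm_one_add_le {w : ℂ} {θ : ℝ} (hθ : 0 ≤ θ) (hθ1 : θ ≤ 1) (h1 : w.re ≤ -(θ / 8))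
    (h2 : w.im ^ 2 ≤ -(w.re / 2)) (h3 : ‖w‖ ≤ 2 / 5) : ‖1 + w‖ ≤ 1 - θ / 16 := by
  have ha := (abs_le.mp ((Complex.abs_re_le_norm w).trans h3)).1
  refine (abs_le_of_sq_le_sq' ?_ (by linarith)).2
  rw [Complex.sq_norm, Complex.normSq_apply]
  simp only [Complex.add_re, Complex.add_im, Complex.one_re, Complex.one_im, zero_add]
  nlinarith

theorem norm_one_add_add_sq_le {w : ℂ} {θ : ℝ} (hθ : 0 ≤ θ) (h1 : w.re ≤ -(θ / 8))
    (h2 : w.im ^ 2 ≤ -(w.re / 2)) (h3 : ‖w‖ ≤ 2 / 5) : ‖1 + (w + w ^ 2)‖ ≤ 1 - θ / 16 := by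
  have ha := (abs_le.mp ((Complex.abs_re_le_norm w).trans h3)).1
  have hb := abs_le.mp ((Complex.abs_im_le_norm w).trans h3)
  -- With `w = a + ib`, the squared modulus is `(1 + a + a²)² - b²(1 - 2a(1 + a) - b²)`, so the
  -- imaginary part only helps.
  have h4 : ‖1 + (w + w ^ 2)‖ ≤ 1 + w.re + w.re ^ 2 := by
    refine (abs_le_of_sq_le_sq' ?_ (by nlinarith)).2
    rw [Complex.sq_norm, Complex.normSq_apply]
    simp only [Complex.add_re, Complex.add_im, Complex.one_re, Complex.one_im, zero_add, sq,
      Complex.mul_re, Complex.mul_im]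
    have : 0 ≤ w.im ^ 2 * (1 - 2 * w.re * (1 + w.re) - w.im ^ 2) :=
      mul_nonneg (sq_nonneg _) (by nlinarith)
    linarith
  nlinarith

end Minimax

end

/-! ### Iteration count and conclusion. -/

theorem mul_pow_mul_pow_le_one {s T : ℕ} {K Y : ℝ} (hs : 1 ≤ s) (hK : 2 ≤ K) (hY : 1 ≤ Y)
    (hT : 224 * (s * K * Real.log (s * K * Y)) ≤ T) :
    1 ≤ T ∧ s * Y * (T : ℝ) ^ (s - 1) * (1 - 1 / 16 / K) ^ ((T : ℤ) - (s : ℤ) + 1) ≤ 1 := by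
  have hs' : (1 : ℝ) ≤ s := by exact_mod_cast hs
  have hX : 2 ≤ s * K := by nlinarith
  have hΛ : s * K ≤ s * K * Y := le_mul_of_one_le_right (by linarith) hY
  have hΛ' : s * Y ≤ s * K * Y := by
    have : 0 ≤ s * Y := by positivity
    nlinarith
  set X := s * K with hXdef
  set Λ := X * Y
  have hlog2 := Real.log_two_gt_d9
  have hl2 : Real.log 2 ≤ Real.log Λ := Real.log_le_log (by norm_num) (by linarith)
  have hlX : Real.log X ≤ Real.log Λ := Real.log_le_log (by linarith) hΛ
  have hsT : (s : ℝ) ≤ T := by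
    have : (s : ℝ) * (1 / 2) ≤ X * Real.log Λ := by
      rw [hXdef, mul_assoc]
      refine mul_le_mul_of_nonneg_left ?_ (by linarith)
      nlinarith
    linarith
  have hsT' : s ≤ T := by exact_mod_cast hsT
  have hT0 : (0 : ℝ) < T := by linarith
  refine ⟨hs.trans hsT', ?_⟩
  obtain ⟨N, hN⟩ : ∃ N : ℕ, T + 1 = s + N := ⟨T + 1 - s, by omega⟩
  have hNz : (T : ℤ) - (s : ℤ) + 1 = (N : ℤ) := by omega
  have hNr : (T : ℝ) - s ≤ N := by
    have : (T : ℝ) + 1 = s + N := by exact_mod_cast hN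
    linarith
  have hKinv : 1 / 16 / K ≤ 1 / 16 := div_le_self (by norm_num) (by linarith)
  have h1 : (1 - 1 / 16 / K) ^ N ≤ Real.exp (-(N * (1 / 16 / K))) := by
    rw [← mul_neg, Real.exp_nat_mul]
    refine pow_le_pow_left₀ (by linarith) ?_ N
    linarith [Real.add_one_le_exp (-(1 / 16 / K))]
  have h2 : (T : ℝ) ^ (s - 1) ≤ Real.exp (s * Real.log T) := by
    rw [Real.exp_nat_mul, Real.exp_log hT0]
    exact pow_le_pow_right₀ (by linarith) (by omega)
  have h3 : s * Y ≤ Real.exp (s * Real.log Λ) := by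
    have hΛ0 : 0 < Λ := by linarith
    rw [Real.exp_nat_mul, Real.exp_log hΛ0]
    exact hΛ'.trans (le_self_pow₀ (by linarith) (by omega))
  rw [hNz, zpow_natCast]
  have hmain : s * Real.log Λ + s * Real.log T + -(N * (1 / 16 / K)) ≤ 0 := by
    -- With this scale the decay exponent `T/(16K)` equals `2as`. Since `log a ≤ a - 1`, and `log 32
    -- + log X ≤ 6 log Λ`, the growth costs at most `s(a + 7 log Λ)` up to lower-order terms; `224 =
    -- 7 · 32` makes `7 log Λ ≤ a`.
    set a := T / (32 * X) with ha
    have hTa : (T : ℝ) = a * (32 * X) := by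
      rw [ha]
      field_simp
    have ha7 : 7 * Real.log Λ ≤ a := by
      rw [ha, le_div_iff₀ (by linarith)]
      linarith
    have ha0 : 0 < a := by linarith
    have hlT : Real.log T ≤ a - 1 + (5 * Real.log 2 + Real.log X) := by
      rw [hTa, Real.log_mul ha0.ne' (by positivity), Real.log_mul (by norm_num) (by positivity)]
      have h32 : Real.log 32 = 5 * Real.log 2 := by
        rw [show (32 : ℝ) = 2 ^ 5 by norm_num, Real.log_pow]
        norm_num
      have := Real.log_le_sub_one_of_pos ha0
      linarith
    have hb : Real.log Λ + Real.log T + 1 / 16 / K ≤ 2 * a := by linarith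
    have hc : s * (2 * a) = T * (1 / 16 / K) := by
      rw [hTa, hXdef]
      field_simp
      norm_num
    have hd : (T - s) * (1 / 16 / K) ≤ N * (1 / 16 / K) := by gcongr
    have := mul_le_mul_of_nonneg_left hb (show (0 : ℝ) ≤ s by positivity)
    linarith
  calc s * Y * (T : ℝ) ^ (s - 1) * (1 - 1 / 16 / K) ^ N
      ≤ Real.exp (s * Real.log Λ) * Real.exp (s * Real.log T) * Real.exp (-(N * (1 / 16 / K))) := by
        have : 0 ≤ (1 - 1 / 16 / K) ^ N := pow_nonneg (by linarith) _
        gcongr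
    _ = Real.exp (s * Real.log Λ + s * Real.log T + -(N * (1 / 16 / K))) := by
        rw [Real.exp_add, Real.exp_add]
    _ ≤ 1 := Real.exp_le_one_iff.mpr hmain

namespace Minimax

theorem Algo.norm_iterate_sub_le {n m : ℕ} (hm : 0 < m) {A : Matrix (Fin m) (Fin m) ℝ}
    {B : Matrix (Fin n) (Fin m) ℝ} {C : Matrix (Fin n) (Fin n) ℝ} {L μ μx r : ℝ}
    (h : QuadAssumption A B C L μ μx) (hr : 2 * (L / μ) ≤ r)
    (D : JordanDecomp ((dynMatrix A B C r).map Complex.ofReal)) (alg : Algo) (zs z₀ : Pt n m)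
    {T : ℕ} (hT : 1 ≤ T ∨ D.maxSize = 1) :
    ‖alg.iterate (quadratic A B C zs) (1 / (4 * r * L)) (1 / (4 * L)) z₀ T - zs‖ ≤
      D.maxSize * D.condP * ‖z₀ - zs‖ * (T : ℝ) ^ (D.maxSize - 1) *
        (1 - 1 / 16 / (r * (L / μx))) ^ ((T : ℤ) - (D.maxSize : ℤ) + 1) := by
  have hμ := h.mu_pos
  have hμx := h.mux_pos
  have hL : 0 < L := hμx.trans_le h.mux_le_L
  have hκ : 1 ≤ L / μ := (one_le_div₀ hμ).mpr (h.mu_le_L hm)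
  have hκx : 1 ≤ L / μx := (one_le_div₀ hμx).mpr h.mux_le_L
  have hr2 : 2 ≤ r := by linarith
  have hr0 : 0 < r := by linarith
  have hrμ : 2 * L ≤ r * μ := by
    have := mul_le_mul_of_nonneg_right hr hμ.le
    rwa [mul_assoc, div_mul_cancel₀ _ hμ.ne'] at this
  have : Nonempty (Fin n ⊕ Fin m) := ⟨Sum.inr ⟨0, hm⟩⟩
  set η : ℝ := 1 / (4 * r * L) with hη
  have hη0 : 0 < η := by positivity
  set θ := 1 / (r * (L / μx)) with hθdef
  have hθ0 : 0 < θ := by positivity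
  have hθ1 : θ ≤ 1 := by
    rw [hθdef, div_le_one (by positivity)]
    nlinarith
  have hMn : ‖(η : ℂ) • (dynMatrix A B C r).map Complex.ofReal‖ ≤ 2 / 5 := by
    rw [norm_smul, Complex.norm_real, Real.norm_of_nonneg hη0.le]
    calc η * ‖(dynMatrix A B C r).map Complex.ofReal‖ ≤ η * (8 / 5 * (r * L)) := by
          gcongr
          exact h.norm_dynMatrix_le hL hr2
      _ = 2 / 5 := by
          rw [hη]
          field_simp
          norm_num
  have hev : ∀ l : ℂ, (∃ v : Fin n ⊕ Fin m → ℂ, v ≠ 0 ∧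
      ((dynMatrix A B C r).map Complex.ofReal).mulVec v = l • v) →
      ((η : ℂ) * l).re ≤ -(θ / 8) ∧ ((η : ℂ) * l).im ^ 2 ≤ -(((η : ℂ) * l).re / 2) ∧
        ‖(η : ℂ) * l‖ ≤ 2 / 5 := by
    rintro l ⟨v, hv, hl⟩
    obtain ⟨h1, h2⟩ := h.eigenvalue_region hr0 hrμ hv hl
    rw [Complex.re_ofReal_mul, Complex.im_ofReal_mul]
    refine ⟨?_, ?_, ?_⟩
    · calc η * l.re ≤ η * -(μx / 2) := by gcongr
        _ = -(θ / 8) := by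
          rw [hη, hθdef]
          field_simp
          norm_num
    · rw [mul_pow]
      calc η ^ 2 * l.im ^ 2 ≤ η ^ 2 * -(2 * r * L * l.re) := by gcongr
        _ = -(η * l.re / 2) := by
          rw [hη]
          field_simp
          norm_num
    · refine (JordanDecomp.norm_eigenvalue_le
        (M := (η : ℂ) • (dynMatrix A B C r).map Complex.ofReal) hv ?_).trans hMn
      rw [Matrix.smul_mulVec, hl, smul_smul]
  have hpow : ‖(1 + ((η : ℂ) • (dynMatrix A B C r).map Complex.ofReal +
      alg.sqCoeff • ((η : ℂ) • (dynMatrix A B C r).map Complex.ofReal) ^ 2)) ^ T‖ ≤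
      D.condP * ∑ j ∈ Finset.range D.maxSize, (T.choose j : ℝ) * (1 - θ / 16) ^ (T - j) := by
    cases alg
    · refine D.norm_one_add_pow_le (d := 2 / 5) (q := 2 / 5) ?_ ?_ ?_ (by norm_num) T
      · intro l hl
        simpa [Algo.sqCoeff] using (hev l hl).2.2
      · intro l hl
        obtain ⟨h1, h2, h3⟩ := hev l hl
        simpa [Algo.sqCoeff] using norm_one_add_le hθ0.le hθ1 h1 h2 h3
      · simpa [Algo.sqCoeff] using hMn
    -- Factoring `w + w² = w(1 + w)` with `|1 + w| ≤ 1` keeps `d` at `2/5`; the cruder `14/25` for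
    -- both would break `d + q ≤ 1`.
    · refine D.norm_one_add_pow_le (d := 2 / 5) (q := 14 / 25) ?_ ?_ ?_ (by norm_num) T
      · intro l hl
        obtain ⟨h1, h2, h3⟩ := hev l hl
        have h4 : ‖1 + (η : ℂ) * l‖ ≤ 1 :=
          (norm_one_add_le hθ0.le hθ1 h1 h2 h3).trans (by linarith)
        rw [Algo.sqCoeff, one_mul]
        calc ‖(η : ℂ) * l + ((η : ℂ) * l) ^ 2‖ = ‖(η : ℂ) * l‖ * ‖1 + (η : ℂ) * l‖ := by
              rw [← norm_mul]
              ring_nf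
          _ ≤ 2 / 5 * 1 := mul_le_mul h3 h4 (norm_nonneg _) (by norm_num)
          _ = 2 / 5 := mul_one _
      · intro l hl
        obtain ⟨h1, h2, h3⟩ := hev l hl
        rw [Algo.sqCoeff, one_mul]
        exact norm_one_add_add_sq_le hθ0.le h1 h2 h3
      · rw [Algo.sqCoeff, one_smul]
        calc _ ≤ ‖(η : ℂ) • (dynMatrix A B C r).map Complex.ofReal‖ +
            ‖(η : ℂ) • (dynMatrix A B C r).map Complex.ofReal‖ ^ 2 :=
              (norm_add_le _ _).trans (by gcongr; exact norm_pow_le _ 2)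
          _ ≤ 2 / 5 + (2 / 5) ^ 2 := by gcongr
          _ = 14 / 25 := by norm_num
  have hsum := sum_choose_mul_pow_le (ρ := 1 - θ / 16) (by linarith) (by linarith) hT
  have hθ16 : 1 / 16 / (r * (L / μx)) = θ / 16 := by
    rw [hθdef]
    ring
  rw [hθ16, ← norm_complexCoords, ← norm_complexCoords (z₀ - zs),
    alg.complexCoords_iterate h.symm_A h.symm_C zs z₀ (r := r)
      (show 1 / (4 * L) = r * η by rw [hη]; field_simp) T]
  have hcond : 0 ≤ D.condP := zero_le_one.trans D.one_le_condP
  refine (Matrix.l2_opNorm_mulVec _ (WithLp.toLp 2 (complexCoords (z₀ - zs)))).trans ?_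
  refine (mul_le_mul_of_nonneg_right (hpow.trans (mul_le_mul_of_nonneg_left hsum hcond))
    (norm_nonneg _)).trans_eq ?_
  ring

end Minimax

theorem theorem5 :
    ∃ c₀ c₁ : ℝ, 0 < c₀ ∧ c₀ < 1 ∧ 0 < c₁ ∧
      ∀ (n m : ℕ) (_ : 0 < m)
        (A : Matrix (Fin m) (Fin m) ℝ) (B : Matrix (Fin n) (Fin m) ℝ)
        (C : Matrix (Fin n) (Fin n) ℝ) (zs : Minimax.Pt n m)
        (L μ μx κ κx r : ℝ)
        (_ : Minimax.QuadAssumption A B C L μ μx)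
        (_ : κ = L / μ) (_ : κx = L / μx) (_ : 2 * κ ≤ r)
        (D : Minimax.JordanDecomp ((Minimax.dynMatrix A B C r).map Complex.ofReal))
        (alg : Minimax.Algo) (z₀ : Minimax.Pt n m),
        (∀ T : ℕ, (1 ≤ T ∨ D.maxSize = 1) →
          ‖alg.iterate (Minimax.quadratic A B C zs) (1 / (4 * r * L)) (1 / (4 * L)) z₀ T - zs‖ ≤
            D.maxSize * D.condP * ‖z₀ - zs‖ * (T : ℝ) ^ (D.maxSize - 1) *
              (1 - c₀ / (r * κx)) ^ ((T : ℤ) - (D.maxSize : ℤ) + 1)) ∧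
        (∀ ε : ℝ, 0 < ε → ε ≤ ‖z₀ - zs‖ →
          ∃ T₀ : ℕ,
            ((alg.gradCalls * T₀ : ℕ) : ℝ) ≤
              c₁ * (D.maxSize * r * κx *
                Real.log (D.maxSize * r * κx * D.condP * ‖z₀ - zs‖ / ε)) ∧
            ∀ T : ℕ, T₀ ≤ T →
              ‖alg.iterate (Minimax.quadratic A B C zs) (1 / (4 * r * L)) (1 / (4 * L)) z₀ T
                - zs‖ ≤ ε) := by
  -- `450` absorbs two gradient calls and the ceiling: `2(224W + 1) ≤ 450W` for `W ≥ 1`.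
  refine ⟨1 / 16, 450, by norm_num, by norm_num, by norm_num, ?_⟩
  rintro n m hm A B C zs L μ μx κ κx r h rfl rfl hr D alg z₀
  refine ⟨fun T hT => alg.norm_iterate_sub_le hm h hr D zs z₀ hT, fun ε hε hεz => ?_⟩
  have hκ : 1 ≤ L / μ := (one_le_div₀ h.mu_pos).mpr (h.mu_le_L hm)
  have hκx : 1 ≤ L / μx := (one_le_div₀ h.mux_pos).mpr h.mux_le_L
  have : Nonempty (Fin n ⊕ Fin m) := ⟨Sum.inr ⟨0, hm⟩⟩
  have hs : 1 ≤ D.maxSize := D.maxSize_pos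
  have hs' : (1 : ℝ) ≤ D.maxSize := by exact_mod_cast hs
  have hK : 2 ≤ r * (L / μx) := by nlinarith
  have hY : 1 ≤ D.condP * (‖z₀ - zs‖ / ε) :=
    one_le_mul_of_one_le_of_one_le D.one_le_condP ((one_le_div₀ hε).mpr hεz)
  have harg : D.maxSize * r * (L / μx) * D.condP * ‖z₀ - zs‖ / ε =
      D.maxSize * (r * (L / μx)) * (D.condP * (‖z₀ - zs‖ / ε)) := by ring
  rw [harg, mul_assoc (D.maxSize : ℝ) r]
  have hX : 2 ≤ D.maxSize * (r * (L / μx)) := by nlinarith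
  have hlog : Real.log 2 ≤
      Real.log (D.maxSize * (r * (L / μx)) * (D.condP * (‖z₀ - zs‖ / ε))) :=
    Real.log_le_log (by norm_num) (by nlinarith)
  set W := D.maxSize * (r * (L / μx)) *
    Real.log (D.maxSize * (r * (L / μx)) * (D.condP * (‖z₀ - zs‖ / ε))) with hW
  have hW1 : 1 ≤ W := by nlinarith [Real.log_two_gt_d9]
  refine ⟨⌈224 * W⌉₊, ?_, fun T hT => ?_⟩
  · have h1 := (Nat.ceil_lt_add_one (show 0 ≤ 224 * W by linarith)).le
    have h2 : (alg.gradCalls : ℝ) ≤ 2 := by cases alg <;> norm_num [Minimax.Algo.gradCalls]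
    rw [Nat.cast_mul]
    calc (alg.gradCalls : ℝ) * (⌈224 * W⌉₊ : ℝ) ≤ 2 * (224 * W + 1) := by gcongr
      _ ≤ 450 * W := by linarith
  · obtain ⟨hT1, hle⟩ := mul_pow_mul_pow_le_one hs hK hY (Nat.ceil_le.mp hT)
    refine (alg.norm_iterate_sub_le hm h hr D zs z₀ (Or.inl hT1)).trans ?_
    calc _ = (D.maxSize * (D.condP * (‖z₀ - zs‖ / ε)) * (T : ℝ) ^ (D.maxSize - 1) *
          (1 - 1 / 16 / (r * (L / μx))) ^ ((T : ℤ) - (D.maxSize : ℤ) + 1)) * ε := by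
          field_simp
      _ ≤ 1 * ε := by gcongr
      _ = ε := one_mul ε
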